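/- Let $4<p\le\infty$ and $0\le m\le\infty$, and let $\alpha\in[0,1]$ be given by $\frac1\alpha=\left(\frac14-\frac1p\right)m+1$, where $\frac1p=0$ if $p=\infty$, and $\alpha=0$ if $m=\infty$ (so that $0<\alpha\le1$ whenever $m<\infty$). There is a constant $C(m,p)<\infty$, depending only on $m$ and $p$, such that the following holds. Let $(M^4,g)$ be a smooth Riemannian four-manifold (without boundary, Hausdorff, second countable; not assumed compact, complete or connected) of unit volume, and let $C_S\in[1,\infty]$ be its Sobolev constant, i.e. the smallest constant for which $$\|v\|_{L^4}^2\le C_S\left(\|\nabla v\|_{L^2}^2+V^{-1/2}\|v\|_{L^2}^2\right)\qquad\text{for all }v\in C^1(M),$$ where $V=\operatorname{Vol}(M,g)$ (here $V=1$), norms may take the value $+\infty$, and $C_S=\infty$ if there is no finite such constant. Then for every compactly supported real-valued function $u\in C^1_0(M)$, $$\|u\|_\infty\le C_S\cdot C(m,p)\,\|u\|_m^{1-\alpha}\left(\|\nabla u\|_p+\|u\|_p\right)^{\alpha}.$$ Here $\|f\|_q=\left(\int_M|f|^q\,dV_g\right)^{1/q}$ for $0<q<\infty$ and $\|f\|_\infty=\sup_M|f|$.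 For $m=0$ we have $\alpha=1$ and the factor $\|u\|_m^{1-\alpha}$ is read as $1$; for $m=\infty$ the last factor, having exponent $\alpha=0$, is read as $1$. On the right-hand side $\infty\cdot0=0$. -/

import Mathlib

open MeasureTheory Bundle Manifold
open scoped ENNReal NNReal ContDiff

noncomputable section

namespace RiemannianFour

/-- The Euclidean space `ℝ⁴` on which four-manifolds (without boundary) are modelled. -/
abbrev E4 : Type := EuclideanSpace ℝ (Fin 4)

section

variable (M : Type*) [TopologicalSpace M] [ChartedSpace E4 M]
  [RiemannianBundle (fun x : M ↦ TangentSpace (𝓡 4) x)]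

variable {M} in
/-- The coordinate matrix `g_{ij} = g(∂_i, ∂_j)` of the metric in the preferred chart around `x₀`,
as a function of the coordinates `y`, where `∂_i` is the image of the `i`-th standard basis vector
under the differential of the inverse chart. -/
def chartMetric (x₀ : M) (y : E4) : Matrix (Fin 4) (Fin 4) ℝ :=
  Matrix.of fun i j ↦
    inner ℝ
      (mfderiv 𝓘(ℝ, E4) (𝓡 4) (extChartAt (𝓡 4) x₀).symm y (EuclideanSpace.single i (1 : ℝ)))
      (mfderiv 𝓘(ℝ, E4) (𝓡 4) (extChartAt (𝓡 4) x₀).symm y (EuclideanSpace.single j (1 : ℝ)))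

variable [MeasurableSpace M]

variable {M} in
/-- The Riemannian volume of the domain of the preferred chart around `x₀`: the measure
`√(det g_{ij}) dy¹ ⋯ dy⁴` on the target of the chart, transported to `M`. -/
def chartVolume (x₀ : M) : Measure M :=
  Measure.map (extChartAt (𝓡 4) x₀).symm
    ((volume.restrict (extChartAt (𝓡 4) x₀).target).withDensity
      fun y ↦ ENNReal.ofReal (Real.sqrt (chartMetric x₀ y).det))

/-- The Riemannian volume measure `dV`. The measures `chartVolume x₀` agree on overlaps of charts,
so that the measure obtained by patching them together is the smallest measure that dominates
them all, their supremum in the complete lattice of measures on `M`. -/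
def riemannianVolume : Measure M := ⨆ x₀ : M, chartVolume x₀

variable {M} in
/-- The pointwise norm `|∇u|` of the gradient, i.e. the norm of the differential `du` with respect
to the Riemannian metric. -/
def gradNorm (u : M → ℝ) (x : M) : ℝ := ‖mfderiv (𝓡 4) 𝓘(ℝ, ℝ) u x‖

variable {M} in
/-- `‖f‖_p = (∫ |f|^p dV)^{1/p}` for `0 < p < ∞` and `‖f‖_∞ = sup |f|`, with values in `[0, ∞]`.
(For `p = 0` the value is `0`; only its power with exponent `0`, which is `1`, is ever used.) -/
def LNorm (f : M → ℝ) (p : ℝ≥0∞) : ℝ≥0∞ :=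
  if p = ⊤ then ⨆ x, ‖f x‖ₑ else eLpNorm f p (riemannianVolume M)

/-- The Sobolev constant: the smallest `C` in `[0, ∞]` with
`‖v‖₄² ≤ C (‖∇v‖₂² + V^{-1/2} ‖v‖₂²)` for all `v ∈ C¹(M)`, where `V` is the volume of `M`. -/
def sobolevConstant : ℝ≥0∞ :=
  sInf {C : ℝ≥0∞ | ∀ v : M → ℝ, ContMDiff (𝓡 4) 𝓘(ℝ, ℝ) 1 v →
    LNorm v 4 ^ 2 ≤
      C * (LNorm (gradNorm v) 2 ^ 2 +
        riemannianVolume M Set.univ ^ (-(1 / 2) : ℝ) * LNorm v 2 ^ 2)}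

end

/-- The exponent `α` with `1/α = (1/4 - 1/p) m + 1`, computed in `[0, ∞]` (so `1/p = 0` for
`p = ∞`, and `α = 0` for `m = ∞`). -/
def sobolevExponent (m p : ℝ≥0∞) : ℝ := ((4⁻¹ - p⁻¹) * m + 1)⁻¹.toReal

end RiemannianFour

end

/-!
The proof is a Moser iteration. Put `1/r = 1/2 - 1/p`, `1/b = 1/4 - 1/p`, `χ = 4/r = 1 + 4/b > 1`,
`G = ‖∇u‖_p + ‖u‖_p` and `J t = ∫ |u| ^ t`. The Sobolev inequality for `|u| ^ β`, with
`β = t/r + 1`, and Hölder's inequality with exponents `r` and `p` give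
`J (χ t + 4) ≤ (β C_S G) ^ 4 (J t) ^ χ` (`lintegral_rpow_moser_step`); here `1 ≤ C_S`, which the
constant functions show, allows `C_S ^ 2` to be replaced by `C_S ^ 4`.

In the variable `s = t + b` the map `t ↦ χ t + 4` is the dilation `s ↦ χ s`, and the function
`Ψ s = χ ^ (b²/4) (s C_S G) ^ b J (s - b)` satisfies `Ψ (χ s) ≤ (Ψ s) ^ χ`. Hence
`Ψ (χ ^ k s) ≤ (Ψ s) ^ (χ ^ k)`. If `L < sup |u|`, then `J t ≥ c L ^ t` with `c > 0`, because the
volume charges the open set `{|u| > L}`; comparison for large `k` yields `L ^ s ≤ Ψ s`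
(`rpow_le_of_moser_step`). So `(sup |u|) ^ (m + b) ≤ const · (C_S G) ^ b ∫ |u| ^ m` for every
`0 < m < ∞`, without a normalization of `u` and without a lower bound on `m`
(`enorm_rpow_le_of_moser`). The root of order `m + b` is the assertion: `b / (m + b) = α` and
`m / (m + b) = 1 - α`, and `C_S ^ α ≤ C_S`.

For `m = 0` the exponent `1` is used and `∫ |u|` is absorbed into the finite number `sup |u|`; for
`m = ∞` the assertion is `1 ≤ C_S`. When `C_S` or `G` is infinite, the right-hand side is infinite
unless `u = 0`, again since the volume is positive on open sets. That positivity rests on the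
positivity and the continuity of the determinant of the metric in a chart (`chartMetric_det_pos`,
`continuousOn_chartMetric_det`). The measurability of `|∇u|` is never needed
(`lintegral_mul_le_Lp_mul_Lq_of_measurable_left`).
-/

namespace RiemannianFour

/-! ### Positivity of the Riemannian volume on open sets -/

section Geometry

variable {M : Type*} [TopologicalSpace M] [ChartedSpace E4 M]
  [RiemannianBundle (fun x : M ↦ TangentSpace (𝓡 4) x)]

lemma chartMetric_det_pos [IsManifold (𝓡 4) ∞ M] (x₀ : M) {y : E4}
    (hy : y ∈ (extChartAt (𝓡 4) x₀).target) : 0 < (chartMetric x₀ y).det := by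
  have : IsManifold (𝓡 4) 1 M := .of_le (n := ∞) (by norm_cast)
  have hinv := isInvertible_mfderivWithin_extChartAt_symm (I := 𝓡 4) hy
  rw [ModelWithCorners.Boundaryless.range_eq_univ, mfderivWithin_univ] at hinv
  have hli : LinearIndependent ℝ fun i : Fin 4 ↦
      mfderiv 𝓘(ℝ, E4) (𝓡 4) (extChartAt (𝓡 4) x₀).symm y
        (EuclideanSpace.single i (1 : ℝ)) := by
    have h0 : LinearIndependent ℝ fun i : Fin 4 ↦ (EuclideanSpace.single i (1 : ℝ) : E4) := by
      have h := (EuclideanSpace.basisFun (Fin 4) ℝ).toBasis.linearIndependent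
      have hfun : ⇑(EuclideanSpace.basisFun (Fin 4) ℝ) =
          fun i ↦ (EuclideanSpace.single i (1 : ℝ) : E4) := by ext1 i; simp
      rw [OrthonormalBasis.coe_toBasis, hfun] at h
      exact h
    exact h0.map' (mfderiv 𝓘(ℝ, E4) (𝓡 4) (extChartAt (𝓡 4) x₀).symm y).toLinearMap
      (LinearMap.ker_eq_bot.2 hinv.injective)
  exact (Matrix.posDef_gram_of_linearIndependent hli).det_pos

lemma continuousOn_chartMetric_det [IsManifold (𝓡 4) ∞ M]
    [IsContMDiffRiemannianBundle (𝓡 4) ∞ E4 (fun x : M ↦ TangentSpace (𝓡 4) x)] (x₀ : M) :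
    ContinuousOn (fun y ↦ (chartMetric x₀ y).det) (extChartAt (𝓡 4) x₀).target := by
  have : IsManifold (𝓡 4) 1 M := .of_le (n := ∞) (by norm_cast)
  have hopen : IsOpen (extChartAt (𝓡 4) x₀).target := isOpen_extChartAt_target x₀
  have hT := (contMDiffOn_extChartAt_symm (I := 𝓡 4) (n := 1) x₀).continuousOn_tangentMapWithin
    le_rfl hopen.uniqueMDiffOn
  have hcol (i : Fin 4) : ContinuousOn
      (fun y ↦ (⟨(extChartAt (𝓡 4) x₀).symm y, mfderiv 𝓘(ℝ, E4) (𝓡 4) (extChartAt (𝓡 4) x₀).symm y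
        (EuclideanSpace.single i (1 : ℝ))⟩ : TotalSpace E4 (fun x : M ↦ TangentSpace (𝓡 4) x)))
      (extChartAt (𝓡 4) x₀).target := by
    have hs : Continuous (fun y : E4 ↦
        (⟨y, EuclideanSpace.single i (1 : ℝ)⟩ : TangentBundle 𝓘(ℝ, E4) E4)) := by
      have := (tangentBundleModelSpaceHomeomorph 𝓘(ℝ, E4)).symm.continuous.comp
        (Continuous.prodMk (continuous_id (X := E4))
          (continuous_const (y := (EuclideanSpace.single i (1 : ℝ) : E4))))
      exact this
    have h := hT.comp (s := (extChartAt (𝓡 4) x₀).target) hs.continuousOn (fun y hy ↦ hy)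
    refine h.congr fun y hy ↦ ?_
    simp only [Function.comp_apply, tangentMapWithin]
    rw [mfderivWithin_of_isOpen hopen hy]
  have : IsContinuousRiemannianBundle E4 (fun x : M ↦ TangentSpace (𝓡 4) x) := by
    obtain ⟨g, hg, h⟩ := ‹IsContMDiffRiemannianBundle (𝓡 4) ∞ E4
      (fun x : M ↦ TangentSpace (𝓡 4) x)›
    exact ⟨g, hg.continuous, h⟩
  have hent (i j : Fin 4) : ContinuousOn (fun y ↦ chartMetric x₀ y i j)
      (extChartAt (𝓡 4) x₀).target := (hcol i).inner_bundle (hcol j)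
  simp only [Matrix.det_apply]
  fun_prop

variable [MeasurableSpace M] [BorelSpace M] [IsManifold (𝓡 4) ∞ M]
  [IsContMDiffRiemannianBundle (𝓡 4) ∞ E4 (fun x : M ↦ TangentSpace (𝓡 4) x)]

/-- The Riemannian volume charges every nonempty open set, so that a continuous function
vanishing almost everywhere vanishes identically. -/
instance isOpenPosMeasure_riemannianVolume : (riemannianVolume M).IsOpenPosMeasure where
  open_pos U hU := by
    rintro ⟨x, hxU⟩ h0
    have hle : chartVolume x U ≤ riemannianVolume M U := le_iSup (chartVolume (M := M)) x U
    have hzero : chartVolume x U = 0 := le_antisymm (h0 ▸ hle) bot_le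
    have hopen : IsOpen (extChartAt (𝓡 4) x).target := isOpen_extChartAt_target x
    have hsymm : AEMeasurable (extChartAt (𝓡 4) x).symm
        (volume.restrict (extChartAt (𝓡 4) x).target) :=
      (continuousOn_extChartAt_symm x).aemeasurable hopen.measurableSet
    have hdens : AEMeasurable (fun y ↦ ENNReal.ofReal (Real.sqrt (chartMetric x y).det))
        (volume.restrict (extChartAt (𝓡 4) x).target) :=
      ((continuousOn_chartMetric_det x).sqrt.aemeasurable hopen.measurableSet).ennreal_ofReal
    rw [chartVolume, Measure.map_apply_of_aemeasurable
      (hsymm.mono_ac (withDensity_absolutelyContinuous _ _)) hU.measurableSet,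
      withDensity_apply_eq_zero' hdens] at hzero
    set V := (extChartAt (𝓡 4) x).target ∩ (extChartAt (𝓡 4) x).symm ⁻¹' U with hV
    have hVo : IsOpen V := (continuousOn_extChartAt_symm x).isOpen_inter_preimage hopen hU
    have hVne : V.Nonempty := ⟨extChartAt (𝓡 4) x x, mem_extChartAt_target x, by simpa using hxU⟩
    refine (hVo.measure_pos volume hVne).ne' ?_
    rw [Measure.restrict_apply₀' hopen.measurableSet.nullMeasurableSet] at hzero
    refine measure_mono_null (fun y hy ↦ Set.mem_inter (Set.mem_inter ?_ hy.2) hy.1) hzero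
    simpa using chartMetric_det_pos x hy.1

end Geometry

/-! ### Powers of the absolute value of a function -/

section Gradient

lemma contMDiff_abs_rpow {M : Type*} [TopologicalSpace M] [ChartedSpace E4 M] {u : M → ℝ}
    (hu : ContMDiff (𝓡 4) 𝓘(ℝ, ℝ) 1 u) {β : ℝ} (hβ : 1 < β) :
    ContMDiff (𝓡 4) 𝓘(ℝ, ℝ) 1 (fun x ↦ |u x| ^ β) :=
  (contDiff_norm_rpow (E := ℝ) hβ).contMDiff.comp hu

variable {M : Type*} [TopologicalSpace M] [ChartedSpace E4 M]
  [RiemannianBundle (fun x : M ↦ TangentSpace (𝓡 4) x)]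

lemma gradNorm_nonneg (u : M → ℝ) (x : M) : 0 ≤ gradNorm u x :=
  norm_nonneg (mfderiv (𝓡 4) 𝓘(ℝ, ℝ) u x)

lemma gradNorm_const (c : ℝ) : gradNorm (fun _ : M ↦ c) = 0 := by
  ext x
  refine le_antisymm ?_ (gradNorm_nonneg _ x)
  refine ContinuousLinearMap.opNorm_le_bound _ le_rfl fun v ↦ ?_
  rw [mfderiv_const, norm_tangentSpace_vectorSpace]
  exact (norm_zero (E := ℝ)).le.trans (by simp)

/-- The norm on the tangent space of `ℝ` is the one of its structure of Riemannian manifold; it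
equals the absolute value by `norm_tangentSpace_vectorSpace`, but not by unfolding. -/
lemma gradNorm_abs_rpow_le {u : M → ℝ} (hu : ContMDiff (𝓡 4) 𝓘(ℝ, ℝ) 1 u) {β : ℝ}
    (hβ : 1 < β) (x : M) :
    gradNorm (fun x ↦ |u x| ^ β) x ≤ β * |u x| ^ (β - 1) * gradNorm u x := by
  have hd := (hasDerivAt_abs_rpow (u x) hβ).hasFDerivAt.hasMFDerivAt.comp x
    (hu.mdifferentiable (by simp) x).hasMFDerivAt
  have hpos : 0 ≤ β * |u x| ^ (β - 1) := by positivity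
  refine ContinuousLinearMap.opNorm_le_bound _ (mul_nonneg hpos (gradNorm_nonneg u x)) fun v ↦ ?_
  set w : ℝ := mfderiv (𝓡 4) 𝓘(ℝ, ℝ) u x v with hw
  have h1 : mfderiv (𝓡 4) 𝓘(ℝ, ℝ) (fun x ↦ |u x| ^ β) x v = w * (β * |u x| ^ (β - 2) * u x) :=
    congrArg (fun L ↦ L v) hd.mfderiv
  have h2 : ‖w‖ ≤ gradNorm u x * ‖v‖ := by
    have := (mfderiv (𝓡 4) 𝓘(ℝ, ℝ) u x).le_opNorm v
    rwa [norm_tangentSpace_vectorSpace] at this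
  have h3 : |u x| ^ (β - 2) * |u x| = |u x| ^ (β - 1) := by
    rw [← Real.rpow_add_one' (abs_nonneg _) (by linarith)]
    ring_nf
  rw [norm_tangentSpace_vectorSpace, h1]
  calc ‖w * (β * |u x| ^ (β - 2) * u x)‖ = β * (|u x| ^ (β - 2) * |u x|) * ‖w‖ := by
        rw [norm_mul, norm_mul, norm_mul, Real.norm_of_nonneg (by linarith : 0 ≤ β),
          Real.norm_of_nonneg (by positivity : 0 ≤ |u x| ^ (β - 2)), Real.norm_eq_abs (u x)]
        ring
    _ ≤ β * |u x| ^ (β - 1) * (gradNorm u x * ‖v‖) := by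
        rw [h3]
        gcongr
    _ = _ := by ring

end Gradient

/-! ### The Moser iteration -/

section Iteration

lemma le_of_mul_rpow_pow_le {D x y χ : ℝ} (hD : 0 < D) (hx : 0 ≤ x) (hy : 0 < y) (hχ : 1 < χ)
    (h : ∀ k : ℕ, D * x ^ (χ ^ k) ≤ y ^ (χ ^ k)) : x ≤ y := by
  by_contra! hlt
  have hx' : 0 < x := hy.trans hlt
  have hlim : Filter.Tendsto (fun k : ℕ ↦ (y / x) ^ (χ ^ k)) Filter.atTop (nhds 0) :=
    (tendsto_rpow_atTop_of_base_lt_one _ (by linarith [div_pos hy hx'])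
      ((div_lt_one hx').2 hlt)).comp (tendsto_pow_atTop_atTop_of_one_lt hχ)
  have hle : D ≤ 0 := ge_of_tendsto' hlim fun k ↦ by
    rw [Real.div_rpow hy.le hx, le_div_iff₀ (Real.rpow_pos_of_pos hx' _)]
    exact h k
  linarith

/-- The Moser iteration for a function `J` that behaves like `t ↦ ∫ |u| ^ t`. The weight
`(1 + 4/b) ^ (b²/4) * (s * H) ^ b`, with `s = t + b`, turns the hypothesis into
`Ψ ((1 + 4/b) * s) ≤ Ψ s ^ (1 + 4/b)` for the weighted function `Ψ`; the lower bound
`c * L ^ t ≤ J t` is then compared with `Ψ s` along the sequence `(1 + 4/b) ^ k * s`. -/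
theorem rpow_le_of_moser_step {J : ℝ → ℝ} {b H L c m : ℝ} (hb : 0 < b) (hH : 0 < H) (hL : 0 < L)
    (hc : 0 < c) (hm : 0 < m) (hJ : ∀ t, 0 < t → c * L ^ t ≤ J t)
    (step : ∀ t, 0 < t → J ((1 + 4 / b) * t + 4) ≤ ((t + b) * H) ^ 4 * J t ^ (1 + 4 / b)) :
    L ^ (m + b) ≤ (1 + 4 / b) ^ (b ^ 2 / 4) * ((m + b) * H) ^ b * J m := by
  set χ : ℝ := 1 + 4 / b with hχdef
  have hχ : 1 < χ := by simp only [hχdef]; linarith [div_pos four_pos hb]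
  have hχ0 : 0 < χ := by linarith
  have hχb : χ * b = b + 4 := by simp only [hχdef]; field_simp
  have hJpos : ∀ t, 0 < t → 0 < J t := fun t ht ↦
    (mul_pos hc (Real.rpow_pos_of_pos hL t)).trans_le (hJ t ht)
  set w : ℝ := χ ^ (b ^ 2 / 4) with hw
  have hwpos : 0 < w := Real.rpow_pos_of_pos hχ0 _
  have hwχ : w * χ ^ b = w ^ χ := by
    rw [hw, ← Real.rpow_add hχ0, ← Real.rpow_mul hχ0.le]
    congr 1
    have : b ^ 2 / 4 * χ = b / 4 * (χ * b) := by ring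
    rw [this, hχb]
    ring
  set Ψ : ℝ → ℝ := fun s ↦ w * (s * H) ^ b * J (s - b) with hΨ
  have hΨpos : ∀ s, b < s → 0 < Ψ s := fun s hs ↦
    mul_pos (mul_pos hwpos (Real.rpow_pos_of_pos (mul_pos (hb.trans hs) hH) _))
      (hJpos _ (sub_pos.2 hs))
  have hΨstep : ∀ s, b < s → Ψ (χ * s) ≤ Ψ s ^ χ := by
    intro s hs
    have hsH : 0 < s * H := mul_pos (hb.trans hs) hH
    have h := step (s - b) (sub_pos.2 hs)
    have harg : χ * (s - b) + 4 = χ * s - b := by linarith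
    rw [harg, sub_add_cancel] at h
    have hpw : (s * H) ^ b * (s * H) ^ 4 = ((s * H) ^ b) ^ χ := by
      rw [← Real.rpow_mul hsH.le, mul_comm b χ, hχb, Real.rpow_add hsH]
      norm_num
    calc Ψ (χ * s) = w * χ ^ b * (s * H) ^ b * J (χ * s - b) := by
          simp only [hΨ]
          rw [mul_assoc χ s H, Real.mul_rpow hχ0.le hsH.le]
          ring
      _ ≤ w * χ ^ b * (s * H) ^ b * ((s * H) ^ 4 * J (s - b) ^ χ) := by gcongr
      _ = (w * χ ^ b) * ((s * H) ^ b * (s * H) ^ 4) * J (s - b) ^ χ := by ring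
      _ = Ψ s ^ χ := by
          rw [hwχ, hpw, ← Real.mul_rpow hwpos.le (by positivity),
            ← Real.mul_rpow (by positivity) (hJpos _ (sub_pos.2 hs)).le]
  set s := m + b with hs
  have hbs : b < s := by linarith
  have hs0 : 0 < s := by linarith
  have hpow : ∀ k : ℕ, b < χ ^ k * s := fun k ↦
    hbs.trans_le (le_mul_of_one_le_left hs0.le (one_le_pow₀ hχ.le))
  have hiter : ∀ k : ℕ, Ψ (χ ^ k * s) ≤ Ψ s ^ (χ ^ k) := by
    intro k
    induction k with
    | zero => simp
    | succ k ih =>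
      calc Ψ (χ ^ (k + 1) * s) = Ψ (χ * (χ ^ k * s)) := by ring_nf
        _ ≤ Ψ (χ ^ k * s) ^ χ := hΨstep _ (hpow k)
        _ ≤ (Ψ s ^ (χ ^ k)) ^ χ := Real.rpow_le_rpow (hΨpos _ (hpow k)).le ih hχ0.le
        _ = Ψ s ^ (χ ^ (k + 1)) := by rw [← Real.rpow_mul (hΨpos s hbs).le, pow_succ]
  have hgoal : L ^ s ≤ Ψ s := by
    refine le_of_mul_rpow_pow_le (D := w * (s * H) ^ b * (c * L ^ (-b))) (by positivity)
      (by positivity) (hΨpos s hbs) hχ fun k ↦ (le_trans ?_ (hiter k))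
    have h1 : c * (L ^ (-b) * (L ^ s) ^ (χ ^ k)) ≤ J (χ ^ k * s - b) := by
      refine le_of_eq_of_le ?_ (hJ _ (sub_pos.2 (hpow k)))
      rw [← Real.rpow_mul hL.le, ← Real.rpow_add hL]
      ring_nf
    have h2 : s * H ≤ χ ^ k * s * H := by
      gcongr
      exact le_mul_of_one_le_left hs0.le (one_le_pow₀ hχ.le)
    calc w * (s * H) ^ b * (c * L ^ (-b)) * (L ^ s) ^ (χ ^ k)
        = w * (s * H) ^ b * (c * (L ^ (-b) * (L ^ s) ^ (χ ^ k))) := by ring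
      _ ≤ w * (χ ^ k * s * H) ^ b * J (χ ^ k * s - b) := by
          have := (hJpos _ (sub_pos.2 (hpow k))).le
          gcongr
  simpa [hΨ, hs] using hgoal

end Iteration

/-! ### Hölder's inequality with one measurable factor -/

section Hoelder

/-- Hölder's inequality in which only the first factor has to be measurable: the product may be
replaced by a measurable minorant with the same integral, and dividing by the first factor
gives a measurable minorant of the second. -/
theorem lintegral_mul_le_Lp_mul_Lq_of_measurable_left {α : Type*} [MeasurableSpace α]
    {μ : Measure α} {a b : ℝ} (hab : a.HolderConjugate b) {f : α → ℝ≥0∞} (hf : Measurable f)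
    (hftop : ∀ x, f x ≠ ⊤) (g : α → ℝ≥0∞) :
    ∫⁻ x, f x * g x ∂μ ≤
      (∫⁻ x, f x ^ a ∂μ) ^ (1 / a) * (∫⁻ x, g x ^ b ∂μ) ^ (1 / b) := by
  obtain ⟨h, hm, hle, heq⟩ := exists_measurable_le_lintegral_eq (μ := μ) (fun x ↦ f x * g x)
  have hg : ∀ x, h x / f x ≤ g x := fun x ↦ ENNReal.div_le_of_le_mul' (hle x)
  have hfg : ∀ x, h x ≤ f x * (h x / f x) := by
    intro x
    rcases eq_or_ne (f x) 0 with h0 | h0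
    · have := hle x
      simp_all
    · rw [ENNReal.mul_div_cancel h0 (hftop x)]
  calc ∫⁻ x, f x * g x ∂μ = ∫⁻ x, h x ∂μ := heq
    _ ≤ ∫⁻ x, (f * fun y ↦ h y / f y) x ∂μ := lintegral_mono hfg
    _ ≤ (∫⁻ x, f x ^ a ∂μ) ^ (1 / a) * (∫⁻ x, (h x / f x) ^ b ∂μ) ^ (1 / b) :=
        ENNReal.lintegral_mul_le_Lp_mul_Lq μ hab hf.aemeasurable (hm.div hf).aemeasurable
    _ ≤ _ := by
        have := hab.symm.nonneg
        gcongr with x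
        exact hg x

end Hoelder

/-! ### The Sobolev inequality applied to powers -/

section Sobolev

variable {M : Type*} [TopologicalSpace M] [ChartedSpace E4 M]
  [RiemannianBundle (fun x : M ↦ TangentSpace (𝓡 4) x)] [MeasurableSpace M]

lemma LNorm_of_ne_top (f : M → ℝ) {q : ℝ≥0∞} (hq0 : q ≠ 0) (hq : q ≠ ⊤) :
    LNorm f q = (∫⁻ x, ‖f x‖ₑ ^ q.toReal ∂riemannianVolume M) ^ (1 / q.toReal) := by
  rw [LNorm, if_neg hq, eLpNorm_eq_lintegral_rpow_enorm_toReal hq0 hq]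

lemma LNorm_sq (f : M → ℝ) :
    LNorm f 2 ^ 2 = ∫⁻ x, ‖f x‖ₑ ^ 2 ∂riemannianVolume M := by
  rw [LNorm_of_ne_top f (by simp) (by simp), ← ENNReal.rpow_natCast, ← ENNReal.rpow_mul]
  simp

lemma one_le_sobolevConstant (hvol : riemannianVolume M Set.univ = 1) :
    1 ≤ sobolevConstant M := by
  refine le_sInf fun C hC ↦ ?_
  have h := hC (fun _ ↦ 1) contMDiff_const
  have h0 : LNorm (0 : M → ℝ) 2 = 0 := by simp [LNorm]
  have h1 (q : ℝ≥0∞) (hq0 : q ≠ 0) (hq : q ≠ ⊤) : LNorm (fun _ : M ↦ (1 : ℝ)) q = 1 := by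
    rw [LNorm_of_ne_top _ hq0 hq]
    simp [hvol]
  rw [gradNorm_const, h0, h1 4 (by simp) (by simp), h1 2 (by simp) (by simp), hvol] at h
  simpa using h

/-- The infimum defining the Sobolev constant is attained, so that the Sobolev inequality holds
with the Sobolev constant itself. -/
lemma sobolev_inequality (hvol : riemannianVolume M Set.univ = 1) (hS : sobolevConstant M ≠ ⊤)
    {v : M → ℝ} (hv : ContMDiff (𝓡 4) 𝓘(ℝ, ℝ) 1 v) :
    LNorm v 4 ^ 2 ≤ sobolevConstant M * (LNorm (gradNorm v) 2 ^ 2 + LNorm v 2 ^ 2) := by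
  have hle : ∀ C ∈ {C : ℝ≥0∞ | ∀ v : M → ℝ, ContMDiff (𝓡 4) 𝓘(ℝ, ℝ) 1 v →
      LNorm v 4 ^ 2 ≤ C * (LNorm (gradNorm v) 2 ^ 2 +
        riemannianVolume M Set.univ ^ (-(1 / 2) : ℝ) * LNorm v 2 ^ 2)},
      LNorm v 4 ^ 2 ≤ C * (LNorm (gradNorm v) 2 ^ 2 + LNorm v 2 ^ 2) := by
    intro C hC
    simpa [hvol] using hC v hv
  rcases eq_or_ne (LNorm (gradNorm v) 2 ^ 2 + LNorm v 2 ^ 2) ⊤ with hX | hX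
  · rw [hX, ENNReal.mul_top (one_pos.trans_le (one_le_sobolevConstant hvol)).ne']
    exact le_top
  rcases eq_or_ne (LNorm (gradNorm v) 2 ^ 2 + LNorm v 2 ^ 2) 0 with hX0 | hX0
  · obtain ⟨C, hC, -⟩ := sInf_lt_iff.1 (lt_top_iff_ne_top.2 hS)
    simpa [hX0] using hle C hC
  · rw [← ENNReal.div_le_iff hX0 hX]
    refine le_sInf fun C hC ↦ ?_
    rw [ENNReal.div_le_iff hX0 hX]
    exact hle C hC

/-- Hölder's inequality `‖f g‖₂ ≤ ‖f‖_r ‖g‖_p` for `1/r + 1/p = 1/2`, with the squares taken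
under the integrals. -/
lemma lintegral_mul_sq_le {f : M → ℝ} (hf : Measurable f) (g : M → ℝ) {p : ℝ≥0∞} (hp : 4 < p)
    {r : ℝ} (hr : r⁻¹ = 1 / 2 - (p⁻¹).toReal) :
    ∫⁻ x, ‖f x * g x‖ₑ ^ 2 ∂riemannianVolume M ≤
      ((∫⁻ x, ‖f x‖ₑ ^ r ∂riemannianVolume M) ^ r⁻¹ * LNorm g p) ^ 2 := by
  simp only [enorm_mul, mul_pow]
  rcases eq_or_ne p ⊤ with rfl | hptop
  · have hr2 : r = 2 := by
      rw [← inv_inv r, hr]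
      norm_num
    have hsq : ((∫⁻ x, ‖f x‖ₑ ^ r ∂riemannianVolume M) ^ r⁻¹) ^ 2 =
        ∫⁻ x, ‖f x‖ₑ ^ 2 ∂riemannianVolume M := by
      rw [← ENNReal.rpow_natCast, ← ENNReal.rpow_mul, hr2]
      simp
    rw [hsq, ← lintegral_mul_const _ (hf.enorm.pow_const 2)]
    refine lintegral_mono fun x ↦ ?_
    gcongr
    simpa [LNorm] using le_iSup (fun x ↦ ‖g x‖ₑ) x
  · have hp0 : p ≠ 0 := (bot_lt_of_lt hp).ne'
    have hp4 : 4 < p.toReal := by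
      simpa using (ENNReal.toReal_lt_toReal (by simp) hptop).2 hp
    rw [ENNReal.toReal_inv] at hr
    have hpi : p.toReal⁻¹ < 1 / 4 := by
      rw [inv_lt_comm₀ (by linarith) (by norm_num)]
      simpa using hp4
    have hrpos : 0 < r := inv_pos.1 (by rw [hr]; linarith)
    have hconj : (r / 2).HolderConjugate (p.toReal / 2) := by
      have hpi0 : 0 < p.toReal⁻¹ := inv_pos.2 (by linarith)
      have hr2 : 2 < r := by
        rw [← inv_inv r, hr, lt_inv_comm₀ two_pos (by linarith)]
        linarith
      refine Real.holderConjugate_iff.2 ⟨by linarith, ?_⟩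
      rw [inv_div, inv_div, div_eq_mul_inv, div_eq_mul_inv, hr]
      ring
    -- Only `f` is known to be measurable: `g` stands for `|∇u|`.
    have h := lintegral_mul_le_Lp_mul_Lq_of_measurable_left (μ := riemannianVolume M) hconj
      (hf.enorm.pow_const 2) (fun x ↦ by simp) (fun x ↦ ‖g x‖ₑ ^ 2)
    refine h.trans (le_of_eq ?_)
    rw [LNorm_of_ne_top g hp0 hptop]
    have e1 (a : ℝ) (y : ℝ≥0∞) : (y ^ 2) ^ (a / 2) = y ^ a := by
      rw [← ENNReal.rpow_natCast, ← ENNReal.rpow_mul]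
      congr 1
      push_cast
      ring
    have e2 (a : ℝ) (y : ℝ≥0∞) : y ^ (1 / (a / 2)) = (y ^ (a⁻¹)) ^ 2 := by
      rw [← ENNReal.rpow_natCast, ← ENNReal.rpow_mul]
      congr 1
      rw [one_div_div, div_eq_mul_inv]
      push_cast
      ring
    simp only [e1, e2]
    rw [one_div, ← mul_pow]

variable [BorelSpace M]

/-- The Sobolev inequality for `|u| ^ β` with `β = t / r + 1`, combined with Hölder's inequality,
bounds one integral of a power of `|u|` by a lower one. This is the basic step of the Moser
iteration. -/
lemma lintegral_rpow_moser_step (hvol : riemannianVolume M Set.univ = 1)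
    (hS : sobolevConstant M ≠ ⊤) {u : M → ℝ} (hu : ContMDiff (𝓡 4) 𝓘(ℝ, ℝ) 1 u) {p : ℝ≥0∞}
    (hp : 4 < p) {r : ℝ} (hr : r⁻¹ = 1 / 2 - (p⁻¹).toReal) (hr0 : 0 < r) {t : ℝ} (ht : 0 < t) :
    ∫⁻ x, ‖u x‖ₑ ^ (4 * (t / r + 1)) ∂riemannianVolume M ≤
      (ENNReal.ofReal (t / r + 1) *
        (sobolevConstant M * (LNorm (gradNorm u) p + LNorm u p))) ^ 4 *
        (∫⁻ x, ‖u x‖ₑ ^ t ∂riemannianVolume M) ^ (4 / r) := by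
  set β := t / r + 1 with hβ
  have hβ1 : 1 < β := by linarith [div_pos ht hr0]
  set μ := riemannianVolume M with hμ
  set A := (∫⁻ x, ‖u x‖ₑ ^ t ∂μ) ^ r⁻¹ with hA
  have hmeas : Measurable fun x ↦ |u x| ^ (β - 1) :=
    (hu.continuous.measurable.norm).pow_const _
  have hfA : (∫⁻ x, ‖|u x| ^ (β - 1)‖ₑ ^ r ∂μ) ^ r⁻¹ = A := by
    rw [hA]
    congr 2 with x
    rw [Real.enorm_rpow_of_nonneg (abs_nonneg _) (by linarith), ← Real.norm_eq_abs, enorm_norm,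
      ← ENNReal.rpow_mul]
    congr 1
    rw [hβ]
    field_simp
    ring
  have h4 : LNorm (fun x ↦ |u x| ^ β) 4 ^ 2 = (∫⁻ x, ‖u x‖ₑ ^ (4 * β) ∂μ) ^ (1 / 2 : ℝ) := by
    rw [LNorm_of_ne_top _ (by simp) (by simp), ← ENNReal.rpow_natCast, ← ENNReal.rpow_mul]
    congr 1
    · refine lintegral_congr fun x ↦ ?_
      rw [Real.enorm_rpow_of_nonneg (abs_nonneg _) (by linarith), ← Real.norm_eq_abs, enorm_norm,
        ← ENNReal.rpow_mul, mul_comm β]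
      simp
    · norm_num
  have h2 : LNorm (fun x ↦ |u x| ^ β) 2 ^ 2 ≤ (A * LNorm u p) ^ 2 := by
    rw [LNorm_sq, ← hfA]
    refine le_of_eq_of_le (lintegral_congr fun x ↦ ?_) (lintegral_mul_sq_le hmeas u hp hr)
    rw [enorm_mul, ← enorm_norm (u x), Real.norm_eq_abs, ← enorm_mul,
      ← Real.rpow_add_one' (abs_nonneg _) (by linarith), sub_add_cancel]
  have hg : LNorm (gradNorm fun x ↦ |u x| ^ β) 2 ^ 2 ≤
      (ENNReal.ofReal β * (A * LNorm (gradNorm u) p)) ^ 2 := by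
    rw [LNorm_sq, mul_pow, ← hfA]
    refine le_trans ?_ (mul_le_mul_right (lintegral_mul_sq_le hmeas (gradNorm u) hp hr) _)
    rw [← lintegral_const_mul' _ _ (by simp)]
    refine lintegral_mono fun x ↦ ?_
    rw [← mul_pow, ← Real.enorm_of_nonneg (by linarith : 0 ≤ β), ← enorm_mul]
    refine pow_le_pow_left' (enorm_le_iff_norm_le.2 ?_) 2
    rw [Real.norm_of_nonneg (gradNorm_nonneg _ x), Real.norm_of_nonneg
      (by have := gradNorm_nonneg u x; positivity), ← mul_assoc]
    exact gradNorm_abs_rpow_le hu hβ1 x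
  have hβe : 1 ≤ ENNReal.ofReal β := by simpa using hβ1.le
  set S := sobolevConstant M with hSdef
  have hS1 : 1 ≤ S := one_le_sobolevConstant hvol
  set G := LNorm (gradNorm u) p + LNorm u p with hG
  have hmain : (∫⁻ x, ‖u x‖ₑ ^ (4 * β) ∂μ) ^ (1 / 2 : ℝ) ≤
      (ENNReal.ofReal β * (S * G)) ^ 2 * A ^ 2 := by
    rw [← h4]
    calc _ ≤ S * (LNorm (gradNorm fun x ↦ |u x| ^ β) 2 ^ 2 + LNorm (fun x ↦ |u x| ^ β) 2 ^ 2) :=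
          sobolev_inequality hvol hS (contMDiff_abs_rpow hu hβ1)
      _ ≤ S * ((ENNReal.ofReal β * (A * LNorm (gradNorm u) p)) ^ 2 +
            (ENNReal.ofReal β * (A * LNorm u p)) ^ 2) := by
          refine mul_le_mul_right (add_le_add hg (h2.trans ?_)) _
          exact pow_le_pow_left' (le_mul_of_one_le_left bot_le hβe) 2
      _ ≤ S ^ 2 * (ENNReal.ofReal β * (A * LNorm (gradNorm u) p) +
            ENNReal.ofReal β * (A * LNorm u p)) ^ 2 := by
          gcongr
          · exact le_self_pow hS1 (by simp)
          · rw [add_sq]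
            refine add_le_add_left ?_ _
            exact le_self_add
      _ = _ := by rw [hG]; ring
  calc ∫⁻ x, ‖u x‖ₑ ^ (4 * β) ∂μ = ((∫⁻ x, ‖u x‖ₑ ^ (4 * β) ∂μ) ^ (1 / 2 : ℝ)) ^ 2 := by
        rw [← ENNReal.rpow_natCast, ← ENNReal.rpow_mul]
        simp
    _ ≤ ((ENNReal.ofReal β * (S * G)) ^ 2 * A ^ 2) ^ 2 := by gcongr
    _ = (ENNReal.ofReal β * (S * G)) ^ 4 * A ^ 4 := by ring
    _ = _ := by
        congr 1
        rw [hA, ← ENNReal.rpow_natCast, ← ENNReal.rpow_mul]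
        congr 1
        push_cast
        ring

end Sobolev

/-! ### The Sobolev exponent -/

section Exponent

lemma exponent_gap_pos {p : ℝ≥0∞} (hp : 4 < p) : 0 < 1 / 4 - (p⁻¹).toReal := by
  have h : (p⁻¹).toReal < (4⁻¹ : ℝ≥0∞).toReal :=
    (ENNReal.toReal_lt_toReal (ENNReal.inv_ne_top.2 (bot_lt_of_lt hp).ne') (by simp)).2
      (ENNReal.inv_lt_inv.2 hp)
  simp only [ENNReal.toReal_inv, ENNReal.toReal_ofNat] at h ⊢
  linarith

lemma sobolevExponent_top {p : ℝ≥0∞} (hp : 4 < p) : sobolevExponent ⊤ p = 0 := by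
  have : (4⁻¹ - p⁻¹ : ℝ≥0∞) ≠ 0 := (tsub_pos_of_lt (ENNReal.inv_lt_inv.2 hp)).ne'
  simp [sobolevExponent, ENNReal.mul_top this]

lemma sobolevExponent_of_ne_top {m p : ℝ≥0∞} (hp : 4 < p) (hm : m ≠ ⊤) {b : ℝ}
    (hb : b⁻¹ = 1 / 4 - (p⁻¹).toReal) : sobolevExponent m p = b / (m.toReal + b) := by
  have hb0 : 0 < b := inv_pos.1 (hb ▸ exponent_gap_pos hp)
  have hsub : (4⁻¹ - p⁻¹ : ℝ≥0∞).toReal = b⁻¹ := by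
    rw [ENNReal.toReal_sub_of_le (ENNReal.inv_lt_inv.2 hp).le (by simp), hb]
    simp
  have hne : (4⁻¹ - p⁻¹ : ℝ≥0∞) ≠ ⊤ := ENNReal.sub_ne_top (by simp)
  rw [sobolevExponent, ENNReal.toReal_inv,
    ENNReal.toReal_add (ENNReal.mul_ne_top hne hm) ENNReal.one_ne_top, ENNReal.toReal_mul, hsub]
  simp only [ENNReal.toReal_one]
  field_simp

end Exponent

/-! ### The pointwise bound -/

section Bound

variable {M : Type*} [TopologicalSpace M] [ChartedSpace E4 M]
  [RiemannianBundle (fun x : M ↦ TangentSpace (𝓡 4) x)] [MeasurableSpace M]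

lemma lintegral_enorm_rpow_le (hvol : riemannianVolume M Set.univ = 1) (u : M → ℝ) {t : ℝ}
    (ht : 0 ≤ t) : ∫⁻ x, ‖u x‖ₑ ^ t ∂riemannianVolume M ≤ LNorm u ⊤ ^ t := by
  calc ∫⁻ x, ‖u x‖ₑ ^ t ∂riemannianVolume M ≤ ∫⁻ _, LNorm u ⊤ ^ t ∂riemannianVolume M := by
        refine lintegral_mono fun x ↦ ?_
        gcongr
        simpa [LNorm] using le_iSup (fun x ↦ ‖u x‖ₑ) x
    _ = LNorm u ⊤ ^ t := by simp [hvol]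

lemma LNorm_top_ne_top {u : M → ℝ} (hu : Continuous u) (hc : HasCompactSupport u) :
    LNorm u ⊤ ≠ ⊤ := by
  obtain ⟨B, hB⟩ := hu.bounded_above_of_compact_support hc
  have : LNorm u ⊤ ≤ ENNReal.ofReal B := by
    simp only [LNorm, if_true]
    refine iSup_le fun x ↦ ?_
    rw [← ofReal_norm]
    exact ENNReal.ofReal_le_ofReal (hB x)
  exact ne_top_of_le_ne_top ENNReal.ofReal_ne_top this

variable [BorelSpace M]

lemma LNorm_ne_zero [IsManifold (𝓡 4) ∞ M]
    [IsContMDiffRiemannianBundle (𝓡 4) ∞ E4 (fun x : M ↦ TangentSpace (𝓡 4) x)]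
    {u : M → ℝ} (hu : Continuous u) {x : M} (hx : u x ≠ 0) {q : ℝ≥0∞} (hq : q ≠ 0) :
    LNorm u q ≠ 0 := by
  intro h
  rcases eq_or_ne q ⊤ with rfl | hqt
  · simp only [LNorm, if_true, ENNReal.iSup_eq_zero] at h
    exact hx (by simpa using h x)
  · rw [LNorm, if_neg hqt, eLpNorm_eq_zero_iff hu.measurable.aestronglyMeasurable hq] at h
    exact hx (congrFun ((hu.ae_eq_iff_eq (riemannianVolume M) continuous_const).1 h) x)

/-- Moser iteration along the inequalities of `lintegral_rpow_moser_step`: a pointwise bound by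
the integral of any positive power. -/
theorem enorm_rpow_le_of_moser [IsManifold (𝓡 4) ∞ M]
    [IsContMDiffRiemannianBundle (𝓡 4) ∞ E4 (fun x : M ↦ TangentSpace (𝓡 4) x)]
    (hvol : riemannianVolume M Set.univ = 1)
    (hS : sobolevConstant M ≠ ⊤) {u : M → ℝ} (hu : ContMDiff (𝓡 4) 𝓘(ℝ, ℝ) 1 u)
    (hc : HasCompactSupport u) {p : ℝ≥0∞} (hp : 4 < p) {b : ℝ}
    (hb : b⁻¹ = 1 / 4 - (p⁻¹).toReal) (hG : LNorm (gradNorm u) p + LNorm u p ≠ ⊤)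
    {t : ℝ} (ht : 0 < t) (x : M) :
    ‖u x‖ₑ ^ (t + b) ≤ ENNReal.ofReal ((1 + 4 / b) ^ (b ^ 2 / 4) * (t + b) ^ b) *
      (sobolevConstant M * (LNorm (gradNorm u) p + LNorm u p)) ^ b *
      ∫⁻ x, ‖u x‖ₑ ^ t ∂riemannianVolume M := by
  have hb0 : 0 < b := inv_pos.1 (hb ▸ exponent_gap_pos hp)
  have hb4 : 4 ≤ b := by
    have h : b⁻¹ ≤ 4⁻¹ := by
      rw [hb]
      linarith [(p⁻¹).toReal_nonneg]
    exact (inv_le_inv₀ hb0 four_pos).1 h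
  rcases eq_or_ne (u x) 0 with hx | hx
  · simp [hx, ENNReal.zero_rpow_of_pos (by linarith : 0 < t + b)]
  set μ := riemannianVolume M with hμ
  set S := sobolevConstant M with hSdef
  set G := LNorm (gradNorm u) p + LNorm u p with hGdef
  have hp0 : p ≠ 0 := (bot_lt_of_lt hp).ne'
  have hG0 : G ≠ 0 := fun h ↦ LNorm_ne_zero hu.continuous hx hp0 (add_eq_zero.1 h).2
  have hS0 : S ≠ 0 := (one_pos.trans_le (one_le_sobolevConstant hvol)).ne'
  have hSGt : S * G ≠ ⊤ := ENNReal.mul_ne_top hS hG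
  have hH : 0 < (S * G).toReal := ENNReal.toReal_pos (mul_ne_zero hS0 hG0) hSGt
  have hfin : ∀ q : ℝ, 0 < q → ∫⁻ x, ‖u x‖ₑ ^ q ∂μ ≠ ⊤ := fun q hq ↦
    ne_top_of_le_ne_top (ENNReal.rpow_ne_top_of_nonneg hq.le (LNorm_top_ne_top hu.continuous hc))
      (lintegral_enorm_rpow_le hvol u hq.le)
  have hr : (1 / 4 + b⁻¹)⁻¹⁻¹ = 1 / 2 - (p⁻¹).toReal := by
    rw [inv_inv, hb]
    ring
  have hr0 : 0 < (1 / 4 + b⁻¹)⁻¹ := by positivity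
  have step : ∀ q : ℝ, 0 < q → (∫⁻ x, ‖u x‖ₑ ^ ((1 + 4 / b) * q + 4) ∂μ).toReal ≤
      ((q + b) * (S * G).toReal) ^ 4 * (∫⁻ x, ‖u x‖ₑ ^ q ∂μ).toReal ^ (1 + 4 / b) := by
    intro q hq
    have h := lintegral_rpow_moser_step hvol hS hu hp hr hr0 hq
    have e1 : 4 * (q / (1 / 4 + b⁻¹)⁻¹ + 1) = (1 + 4 / b) * q + 4 := by
      field_simp
    have e2 : 4 / (1 / 4 + b⁻¹)⁻¹ = 1 + 4 / b := by
      field_simp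
    rw [e1, e2] at h
    have hχ : 0 ≤ 1 + 4 / b := by positivity
    have h' := ENNReal.toReal_mono (ENNReal.mul_ne_top
      (ENNReal.pow_ne_top (ENNReal.mul_ne_top ENNReal.ofReal_ne_top hSGt))
      (ENNReal.rpow_ne_top_of_nonneg hχ (hfin q hq))) h
    have hβ : 0 ≤ q / (1 / 4 + b⁻¹)⁻¹ + 1 := by positivity
    have hβle : q / (1 / 4 + b⁻¹)⁻¹ + 1 ≤ q + b := by
      rw [div_inv_eq_mul]
      have : b⁻¹ ≤ 1 / 4 := by
        rw [hb]
        linarith [(p⁻¹).toReal_nonneg]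
      nlinarith
    rw [ENNReal.toReal_mul, ENNReal.toReal_pow, ENNReal.toReal_mul, ENNReal.toReal_ofReal hβ,
      ← ENNReal.toReal_rpow] at h'
    refine h'.trans ?_
    gcongr
  -- Every level `L` below `|u x|` is exceeded on a nonempty open set, of positive volume.
  have hlevel : ∀ L : ℝ≥0, 0 < L → (L : ℝ≥0∞) < ‖u x‖ₑ →
      (L : ℝ≥0∞) ^ (t + b) ≤ ENNReal.ofReal ((1 + 4 / b) ^ (b ^ 2 / 4) * (t + b) ^ b) *
        (S * G) ^ b * ∫⁻ x, ‖u x‖ₑ ^ t ∂μ := by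
    intro L hL hLx
    have hopen : IsOpen {y | (L : ℝ≥0∞) < ‖u y‖ₑ} := isOpen_lt continuous_const hu.continuous.enorm
    have hpos : μ {y | (L : ℝ≥0∞) < ‖u y‖ₑ} ≠ 0 := (hopen.measure_pos μ ⟨x, hLx⟩).ne'
    have hne : μ {y | (L : ℝ≥0∞) < ‖u y‖ₑ} ≠ ⊤ :=
      ne_top_of_le_ne_top (hvol ▸ ENNReal.one_ne_top) (measure_mono (Set.subset_univ _))
    have hlow : ∀ q : ℝ, 0 < q → (μ {y | (L : ℝ≥0∞) < ‖u y‖ₑ}).toReal * (L : ℝ) ^ q ≤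
        (∫⁻ x, ‖u x‖ₑ ^ q ∂μ).toReal := by
      intro q hq
      have h : μ {y | (L : ℝ≥0∞) < ‖u y‖ₑ} * (L : ℝ≥0∞) ^ q ≤ ∫⁻ x, ‖u x‖ₑ ^ q ∂μ := by
        rw [mul_comm]
        calc _ ≤ ∫⁻ x in {y | (L : ℝ≥0∞) < ‖u y‖ₑ}, ‖u x‖ₑ ^ q ∂μ := by
              rw [← setLIntegral_const]
              refine setLIntegral_mono' hopen.measurableSet fun y hy ↦ ?_
              gcongr
              exact le_of_lt hy
          _ ≤ _ := setLIntegral_le_lintegral _ _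
      have h' := ENNReal.toReal_mono (hfin q hq) h
      rwa [ENNReal.toReal_mul, ← ENNReal.toReal_rpow, ENNReal.coe_toReal] at h'
    have key := rpow_le_of_moser_step hb0 hH (NNReal.coe_pos.2 hL)
      (ENNReal.toReal_pos hpos hne) ht hlow step
    have key' := ENNReal.ofReal_le_ofReal key
    rw [← ENNReal.ofReal_rpow_of_pos (NNReal.coe_pos.2 hL), ENNReal.ofReal_coe_nnreal,
      Real.mul_rpow (by linarith) hH.le, ← mul_assoc, ENNReal.ofReal_mul (by positivity),
      ENNReal.ofReal_mul (by positivity), ← ENNReal.ofReal_rpow_of_pos hH,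
      ENNReal.ofReal_toReal hSGt, ENNReal.ofReal_toReal (hfin t ht)] at key'
    exact key'
  have htb : 0 < t + b := by linarith
  rw [← ENNReal.le_rpow_inv_iff htb]
  refine ENNReal.le_of_forall_nnreal_lt fun L hL ↦ ?_
  rcases eq_or_ne L 0 with rfl | hL0
  · simp
  rw [ENNReal.le_rpow_inv_iff htb]
  exact hlevel L (pos_iff_ne_zero.2 hL0) hL

end Bound

/-! ### The interpolation inequality -/

section Interpolation

variable {M : Type*} [TopologicalSpace M] [ChartedSpace E4 M]
  [RiemannianBundle (fun x : M ↦ TangentSpace (𝓡 4) x)] [MeasurableSpace M] [BorelSpace M]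
  [IsManifold (𝓡 4) ∞ M]
  [IsContMDiffRiemannianBundle (𝓡 4) ∞ E4 (fun x : M ↦ TangentSpace (𝓡 4) x)]

/-- The interpolation inequality for `0 < m < ∞` and finite norms, with the Sobolev constant
raised to the power `b / (m + b)`, which is the Sobolev exponent. -/
lemma LNorm_top_le_of_pos (hvol : riemannianVolume M Set.univ = 1)
    (hS : sobolevConstant M ≠ ⊤) {u : M → ℝ} (hu : ContMDiff (𝓡 4) 𝓘(ℝ, ℝ) 1 u)
    (hc : HasCompactSupport u) {p : ℝ≥0∞} (hp : 4 < p) {b : ℝ}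
    (hb : b⁻¹ = 1 / 4 - (p⁻¹).toReal) (hG : LNorm (gradNorm u) p + LNorm u p ≠ ⊤)
    {m : ℝ≥0∞} (hm0 : m ≠ 0) (hm : m ≠ ⊤) :
    LNorm u ⊤ ≤
      ENNReal.ofReal ((1 + 4 / b) ^ (b ^ 2 / 4) * (m.toReal + b) ^ b) ^ (m.toReal + b)⁻¹ *
      (sobolevConstant M * (LNorm (gradNorm u) p + LNorm u p)) ^ (b / (m.toReal + b)) *
      LNorm u m ^ (1 - b / (m.toReal + b)) := by
  have hb0 : 0 < b := inv_pos.1 (hb ▸ exponent_gap_pos hp)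
  have hmr : 0 < m.toReal := ENNReal.toReal_pos hm0 hm
  have hs : 0 < m.toReal + b := by linarith
  simp only [LNorm, if_true]
  refine iSup_le fun x ↦ ?_
  have h := (ENNReal.le_rpow_inv_iff hs).2
    (enorm_rpow_le_of_moser hvol hS hu hc hp hb hG hmr x)
  refine h.trans (le_of_eq ?_)
  change _ = _ * (sobolevConstant M * (LNorm (gradNorm u) p + LNorm u p)) ^ (b / (m.toReal + b)) *
      LNorm u m ^ (1 - b / (m.toReal + b))
  rw [LNorm_of_ne_top u hm0 hm, ENNReal.mul_rpow_of_nonneg _ _ (inv_nonneg.2 hs.le),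
    ENNReal.mul_rpow_of_nonneg _ _ (inv_nonneg.2 hs.le), ← ENNReal.rpow_mul _ b,
    ← ENNReal.rpow_mul _ (1 / m.toReal), ← div_eq_mul_inv b]
  congr 2
  field_simp
  ring

/-- The endpoint `m = 0`: the integral of `|u|` is absorbed into the supremum, which is
finite by the compactness of the support. -/
lemma LNorm_top_le_sobolevConstant_mul (hvol : riemannianVolume M Set.univ = 1)
    (hS : sobolevConstant M ≠ ⊤) {u : M → ℝ} (hu : ContMDiff (𝓡 4) 𝓘(ℝ, ℝ) 1 u)
    (hc : HasCompactSupport u) {p : ℝ≥0∞} (hp : 4 < p) {b : ℝ}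
    (hb : b⁻¹ = 1 / 4 - (p⁻¹).toReal) (hG : LNorm (gradNorm u) p + LNorm u p ≠ ⊤) :
    LNorm u ⊤ ≤ ENNReal.ofReal ((1 + 4 / b) ^ (b ^ 2 / 4) * (1 + b) ^ b) ^ b⁻¹ *
      (sobolevConstant M * (LNorm (gradNorm u) p + LNorm u p)) := by
  have hb0 : 0 < b := inv_pos.1 (hb ▸ exponent_gap_pos hp)
  rcases eq_or_ne (LNorm u ⊤) 0 with h0 | h0
  · rw [h0]
    exact bot_le
  have htop := LNorm_top_ne_top hu.continuous hc
  have hs : 0 < 1 + b := by linarith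
  have h : LNorm u ⊤ ^ (1 + b) ≤ ENNReal.ofReal ((1 + 4 / b) ^ (b ^ 2 / 4) * (1 + b) ^ b) *
      (sobolevConstant M * (LNorm (gradNorm u) p + LNorm u p)) ^ b * LNorm u ⊤ := by
    rw [← ENNReal.le_rpow_inv_iff hs]
    conv_lhs => rw [LNorm, if_pos rfl]
    refine iSup_le fun x ↦ (ENNReal.le_rpow_inv_iff hs).2 ?_
    refine (enorm_rpow_le_of_moser hvol hS hu hc hp hb hG one_pos x).trans ?_
    gcongr
    simpa using lintegral_enorm_rpow_le hvol u zero_le_one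
  rw [ENNReal.rpow_add _ _ h0 htop, ENNReal.rpow_one, mul_comm (LNorm u ⊤),
    ENNReal.mul_le_mul_iff_left h0 htop] at h
  have h' := (ENNReal.le_rpow_inv_iff hb0).2 h
  rwa [ENNReal.mul_rpow_of_nonneg _ _ (inv_nonneg.2 hb0.le), ENNReal.rpow_rpow_inv hb0.ne'] at h'

end Interpolation

end RiemannianFour

theorem mainTheorem8 (m p : ℝ≥0∞) (hp : 4 < p) :
    ∃ C : ℝ≥0, ∀ (M : Type*) [TopologicalSpace M] [T2Space M] [SecondCountableTopology M]
      [ChartedSpace (EuclideanSpace ℝ (Fin 4)) M] [IsManifold (𝓡 4) ∞ M]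
      [RiemannianBundle (fun x : M ↦ TangentSpace (𝓡 4) x)]
      [IsContMDiffRiemannianBundle (𝓡 4) ∞ (EuclideanSpace ℝ (Fin 4))
        (fun x : M ↦ TangentSpace (𝓡 4) x)]
      [MeasurableSpace M] [BorelSpace M],
      RiemannianFour.riemannianVolume M Set.univ = 1 →
      ∀ u : M → ℝ, ContMDiff (𝓡 4) 𝓘(ℝ, ℝ) 1 u → HasCompactSupport u →
        RiemannianFour.LNorm u ⊤ ≤
          RiemannianFour.sobolevConstant M * C *
            RiemannianFour.LNorm u m ^ (1 - RiemannianFour.sobolevExponent m p) *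
            (RiemannianFour.LNorm (RiemannianFour.gradNorm u) p + RiemannianFour.LNorm u p) ^
              RiemannianFour.sobolevExponent m p := by
  rcases eq_or_ne m ⊤ with rfl | hm
  · refine ⟨1, ?_⟩
    intro M _ _ _ _ _ _ _ _ _ hvol u hu hc
    rw [RiemannianFour.sobolevExponent_top hp]
    simpa using le_mul_of_one_le_left bot_le (RiemannianFour.one_le_sobolevConstant hvol)
  obtain ⟨b, hb⟩ : ∃ b : ℝ, b⁻¹ = 1 / 4 - (p⁻¹).toReal := ⟨_, inv_inv _⟩
  have hb0 : 0 < b := inv_pos.1 (hb ▸ RiemannianFour.exponent_gap_pos hp)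
  have hs : 0 < m.toReal + b := by positivity
  rw [RiemannianFour.sobolevExponent_of_ne_top hp hm hb]
  have hα0 : 0 < b / (m.toReal + b) := by positivity
  have hα1 : b / (m.toReal + b) ≤ 1 :=
    (div_le_one hs).2 (by linarith [m.toReal_nonneg])
  -- `K` is chosen before the manifold; it is not uniform in `m`, since for `m = 0` the iteration
  -- starts from the exponent `1` instead of `m`.
  obtain ⟨K, hK0, hK⟩ : ∃ K : ℝ, 0 < K ∧ ∀ (M : Type _) [TopologicalSpace M]
      [ChartedSpace (EuclideanSpace ℝ (Fin 4)) M] [IsManifold (𝓡 4) ∞ M]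
      [RiemannianBundle (fun x : M ↦ TangentSpace (𝓡 4) x)]
      [IsContMDiffRiemannianBundle (𝓡 4) ∞ (EuclideanSpace ℝ (Fin 4))
        (fun x : M ↦ TangentSpace (𝓡 4) x)]
      [MeasurableSpace M] [BorelSpace M],
      RiemannianFour.riemannianVolume M Set.univ = 1 → RiemannianFour.sobolevConstant M ≠ ⊤ →
      ∀ u : M → ℝ, ContMDiff (𝓡 4) 𝓘(ℝ, ℝ) 1 u → HasCompactSupport u →
      RiemannianFour.LNorm (RiemannianFour.gradNorm u) p + RiemannianFour.LNorm u p ≠ ⊤ →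
        RiemannianFour.LNorm u ⊤ ≤ ENNReal.ofReal K *
          (RiemannianFour.sobolevConstant M *
            (RiemannianFour.LNorm (RiemannianFour.gradNorm u) p + RiemannianFour.LNorm u p)) ^
            (b / (m.toReal + b)) * RiemannianFour.LNorm u m ^ (1 - b / (m.toReal + b)) := by
    rcases eq_or_ne m 0 with rfl | hm0
    · refine ⟨((1 + 4 / b) ^ (b ^ 2 / 4) * (1 + b) ^ b) ^ b⁻¹, by positivity, ?_⟩
      intro M _ _ _ _ _ _ _ hvol hS u hu hc hG
      have h := RiemannianFour.LNorm_top_le_sobolevConstant_mul hvol hS hu hc hp hb hG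
      rw [ENNReal.ofReal_rpow_of_pos (by positivity)] at h
      simpa [div_self hb0.ne'] using h
    · refine ⟨((1 + 4 / b) ^ (b ^ 2 / 4) * (m.toReal + b) ^ b) ^ (m.toReal + b)⁻¹,
        by positivity, ?_⟩
      intro M _ _ _ _ _ _ _ hvol hS u hu hc hG
      have h := RiemannianFour.LNorm_top_le_of_pos hvol hS hu hc hp hb hG hm0 hm
      rwa [ENNReal.ofReal_rpow_of_pos (by positivity)] at h
  refine ⟨K.toNNReal, ?_⟩
  intro M _ _ _ _ _ _ _ _ _ hvol u hu hc
  have hS1 := RiemannianFour.one_le_sobolevConstant hvol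
  set S := RiemannianFour.sobolevConstant M with hSdef
  set G := RiemannianFour.LNorm (RiemannianFour.gradNorm u) p + RiemannianFour.LNorm u p with hGdef
  change _ ≤ S * ENNReal.ofReal K * _ * _
  by_cases hfin : S ≠ ⊤ ∧ G ≠ ⊤
  · calc RiemannianFour.LNorm u ⊤ ≤ ENNReal.ofReal K * (S * G) ^ (b / (m.toReal + b)) *
          RiemannianFour.LNorm u m ^ (1 - b / (m.toReal + b)) := hK M hvol hfin.1 u hu hc hfin.2
      _ ≤ ENNReal.ofReal K * (S * G ^ (b / (m.toReal + b))) *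
          RiemannianFour.LNorm u m ^ (1 - b / (m.toReal + b)) := by
        rw [ENNReal.mul_rpow_of_nonneg _ _ hα0.le]
        gcongr
        exact (ENNReal.rpow_le_rpow_of_exponent_le hS1 hα1).trans_eq (ENNReal.rpow_one _)
      _ = _ := by ring
  -- `C_S` or `G` is infinite, and no factor on the right vanishes unless `u` does.
  by_cases hu0 : ∀ x, u x = 0
  · simp [RiemannianFour.LNorm, hu0]
  push Not at hu0
  obtain ⟨x, hx⟩ := hu0
  have hp0 : p ≠ 0 := (bot_lt_of_lt hp).ne'
  have hS0 : S ≠ 0 := (one_pos.trans_le hS1).ne'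
  have hKe : ENNReal.ofReal K ≠ 0 := by simpa using hK0
  have hG0 : G ≠ 0 := fun h ↦
    RiemannianFour.LNorm_ne_zero hu.continuous hx hp0 (add_eq_zero.1 h).2
  have hGα : G ^ (b / (m.toReal + b)) ≠ 0 := by
    simp [ENNReal.rpow_eq_zero_iff, hG0, hα0.le]
  have hN : RiemannianFour.LNorm u m ^ (1 - b / (m.toReal + b)) ≠ 0 := by
    rcases eq_or_ne m 0 with rfl | hm0
    · simp [div_self hb0.ne']
    · simp [ENNReal.rpow_eq_zero_iff, RiemannianFour.LNorm_ne_zero hu.continuous hx hm0, hα1]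
  refine le_top.trans_eq (Eq.symm ?_)
  rcases eq_or_ne S ⊤ with hS | hS
  · rw [hS, ENNReal.top_mul hKe, ENNReal.top_mul hN, ENNReal.top_mul hGα]
  · have hG : G = ⊤ := by
      by_contra h
      exact hfin ⟨hS, h⟩
    rw [hG, ENNReal.top_rpow_of_pos hα0]
    exact ENNReal.mul_top (mul_ne_zero (mul_ne_zero hS0 hKe) hN)
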